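/- Let $n\ge 3$. For a square matrix $X$ let $\|X\|$ be its operator norm with respect to the Euclidean (Hermitian) norm, and let $\rho(X)$ be its spectral radius, the largest modulus of a complex eigenvalue of $X$. There is a constant $C_n>0$, depending only on $n$, such that the following two statements hold. (a) Let $\mu$ be a Borel measure on $SL(n,\mathbb R)$ that is orthogonally invariant, that is, invariant under multiplication on the right (or, invariant under multiplication on the left) by all orthogonal matrices of determinant $1$. If $\log\|X\|\in L^1(\mu)$, then $\log\rho(X)\in L^1(\mu)$ and $$\int_{SL(n,\mathbb R)}\log\rho(X)\,d\mu(X)\;\ge\; C_n\int_{SL(n,\mathbb R)}\log\|X\|\,d\mu(X).$$ (b) Let $\mu$ be a Borel measure on $SL(n,\mathbb C)$ that is unitarily invariant, that is, invariant under multiplication on the right (or, invariant under multiplication on the left) by all unitary matrices of determinant $1$. If $\log\|X\|\in L^1(\mu)$, then $\log\rho(X)\in L^1(\mu)$ and $$\int_{SL(n,\mathbb C)}\log\rho(X)\,d\mu(X)\;\ge\; C_n\int_{SL(n,\mathbb C)}\log\|X\|\,d\mu(X).$$ -/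

import Mathlib

open MeasureTheory

namespace MeanRadius

/-- The Borel sigma-algebra of `SL(n, R)`, for the topology of entrywise convergence. -/
instance instMeasurableSpaceSL {n : ℕ} {R : Type*} [CommRing R] [TopologicalSpace R] :
    MeasurableSpace (Matrix.SpecialLinearGroup (Fin n) R) :=
  borel _

instance instBorelSpaceSL {n : ℕ} {R : Type*} [CommRing R] [TopologicalSpace R] :
    BorelSpace (Matrix.SpecialLinearGroup (Fin n) R) :=
  ⟨rfl⟩

/-- The operator norm of a square matrix, for the Euclidean (Hermitian) norm. -/
noncomputable def opNorm {𝕜 : Type*} [RCLike 𝕜] {n : ℕ} (A : Matrix (Fin n) (Fin n) 𝕜) : ℝ :=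
  ‖Matrix.toEuclideanCLM (n := Fin n) (𝕜 := 𝕜) A‖

/-- The spectral radius of a complex square matrix, the largest modulus of an eigenvalue. -/
noncomputable def rho {n : ℕ} (A : Matrix (Fin n) (Fin n) ℂ) : ℝ :=
  (spectralRadius ℂ A).toReal

/-- The spectral radius of a real square matrix, the largest modulus of a complex eigenvalue. -/
noncomputable def realRho {n : ℕ} (A : Matrix (Fin n) (Fin n) ℝ) : ℝ :=
  rho (A.map Complex.ofReal)

/-- A measure on `SL(n, ℝ)` is orthogonally invariant if it is invariant under multiplication by
orthogonal matrices (those of determinant one, which act on `SL(n, ℝ)`), from the right or from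
the left. -/
def IsOrthogonallyInvariant {n : ℕ}
    (μ : Measure (Matrix.SpecialLinearGroup (Fin n) ℝ)) : Prop :=
  (∀ Q : Matrix.SpecialLinearGroup (Fin n) ℝ,
      (Q : Matrix (Fin n) (Fin n) ℝ) ∈ Matrix.orthogonalGroup (Fin n) ℝ →
        μ.map (fun X => X * Q) = μ) ∨
  (∀ Q : Matrix.SpecialLinearGroup (Fin n) ℝ,
      (Q : Matrix (Fin n) (Fin n) ℝ) ∈ Matrix.orthogonalGroup (Fin n) ℝ →
        μ.map (fun X => Q * X) = μ)

/-- A measure on `SL(n, ℂ)` is unitarily invariant if it is invariant under multiplication by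
unitary matrices (those of determinant one, which act on `SL(n, ℂ)`), from the right or from
the left. -/
def IsUnitarilyInvariant {n : ℕ}
    (μ : Measure (Matrix.SpecialLinearGroup (Fin n) ℂ)) : Prop :=
  (∀ U : Matrix.SpecialLinearGroup (Fin n) ℂ,
      (U : Matrix (Fin n) (Fin n) ℂ) ∈ Matrix.unitaryGroup (Fin n) ℂ →
        μ.map (fun X => X * U) = μ) ∨
  (∀ U : Matrix.SpecialLinearGroup (Fin n) ℂ,
      (U : Matrix (Fin n) (Fin n) ℂ) ∈ Matrix.unitaryGroup (Fin n) ℂ →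
        μ.map (fun X => U * X) = μ)

end MeanRadius

open Matrix Polynomial

namespace MeanRadius

/-! The integral bound follows from a pointwise one: there are finitely many fixed rotations `q a`
with `log ‖X‖ ≤ c * ∑ a, log ρ(X * q a)` whenever `det X = 1`. Integrating, each term has the same
integral by invariance. No additive constant is allowed, since `μ` may be infinite. The link is the
trace of `Z⁻¹ - Zᴴ` for `Z = X * Q`, `Q` a rotation. It is the sum of `z⁻¹ - conj z` over the
eigenvalues of `Z`, hence at most `2n sinh((n-1) log ρ(Z))`. It is also `tr(Q⁻¹ * Y)` with `Y = X⁻¹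
- Xᴴ`, and `‖Y‖ ≥ 2 sinh(log ‖X‖)`. For `n ≥ 3` rotations span all matrices, so one of finitely many
such traces is comparable to `‖Y‖`. The resulting factor moves inside by `M sinh s ≤ sinh(M s)`. -/

/-! ### Spectral radius and eigenvalues in determinant one -/

open scoped Matrix.Norms.L2Operator in
theorem opNorm_eq_norm {𝕜 : Type*} [RCLike 𝕜] {n : ℕ} (A : Matrix (Fin n) (Fin n) 𝕜) :
    opNorm A = ‖A‖ := rfl

open scoped Matrix.Norms.L2Operator in
theorem spectralRadius_ne_top {n : ℕ} [NeZero n] (A : Matrix (Fin n) (Fin n) ℂ) :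
    spectralRadius ℂ A ≠ ⊤ :=
  ((spectrum.spectralRadius_le_nnnorm (𝕜 := ℂ) A).trans_lt ENNReal.coe_lt_top).ne

open scoped Matrix.Norms.L2Operator in
theorem rho_le_opNorm {n : ℕ} [NeZero n] (A : Matrix (Fin n) (Fin n) ℂ) :
    rho A ≤ opNorm A := by
  have h := spectrum.spectralRadius_le_nnnorm (𝕜 := ℂ) A
  exact ENNReal.toReal_mono ENNReal.coe_ne_top h

theorem norm_le_rho {n : ℕ} [NeZero n] {A : Matrix (Fin n) (Fin n) ℂ} {z : ℂ}
    (hz : z ∈ A.charpoly.roots) : ‖z‖ ≤ rho A := by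
  have h : (‖z‖₊ : ENNReal) ≤ spectralRadius ℂ A :=
    le_iSup₂ (f := fun k (_ : k ∈ spectrum ℂ A) => (‖k‖₊ : ENNReal)) z
      (mem_spectrum_of_isRoot_charpoly (isRoot_of_mem_roots hz))
  exact ENNReal.toReal_mono (spectralRadius_ne_top A) h

theorem rho_mul_comm {n : ℕ} (A B : Matrix (Fin n) (Fin n) ℂ) : rho (A * B) = rho (B * A) := by
  have h : spectrum ℂ (A * B) = spectrum ℂ (B * A) := by
    ext z
    rw [mem_spectrum_iff_isRoot_charpoly, mem_spectrum_iff_isRoot_charpoly, charpoly_mul_comm]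
  simp only [rho, spectralRadius, h]

theorem _root_.Multiset.prod_norm_le_pow {s : Multiset ℂ} {r : ℝ} (h : ∀ z ∈ s, ‖z‖ ≤ r) :
    ‖s.prod‖ ≤ r ^ s.card := by
  induction s using Multiset.induction_on with
  | empty => simp
  | cons a s ih =>
    have ha := h a (Multiset.mem_cons_self a s)
    have hs := ih fun z hz => h z (Multiset.mem_cons_of_mem hz)
    rw [Multiset.prod_cons, Multiset.card_cons, norm_mul, pow_succ']
    exact mul_le_mul ha hs (norm_nonneg _) ((norm_nonneg _).trans ha)

theorem card_roots_charpoly {n : ℕ} (A : Matrix (Fin n) (Fin n) ℂ) :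
    A.charpoly.roots.card = n := by
  rw [← (IsAlgClosed.splits A.charpoly).natDegree_eq_card_roots, charpoly_natDegree_eq_dim,
    Fintype.card_fin]

theorem one_le_rho {n : ℕ} [NeZero n] {A : Matrix (Fin n) (Fin n) ℂ} (hA : A.det = 1) :
    1 ≤ rho A := by
  have h := Multiset.prod_norm_le_pow fun z (hz : z ∈ A.charpoly.roots) => norm_le_rho hz
  rw [← det_eq_prod_roots_charpoly, hA, norm_one, card_roots_charpoly] at h
  by_contra! h1
  exact absurd h (not_le.2 (pow_lt_one₀ ENNReal.toReal_nonneg h1 (NeZero.ne n)))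

theorem one_le_norm_mul_rho_pow {n : ℕ} [NeZero n] {A : Matrix (Fin n) (Fin n) ℂ}
    (hA : A.det = 1) {z : ℂ} (hz : z ∈ A.charpoly.roots) : 1 ≤ ‖z‖ * rho A ^ (n - 1) := by
  have h : ‖(A.charpoly.roots.erase z).prod‖ ≤ rho A ^ (n - 1) := by
    have hc := Multiset.card_erase_of_mem hz
    rw [card_roots_charpoly, Nat.pred_eq_sub_one] at hc
    rw [← hc]
    exact Multiset.prod_norm_le_pow fun w hw => norm_le_rho (Multiset.mem_of_mem_erase hw)
  have h1 : ‖z‖ * ‖(A.charpoly.roots.erase z).prod‖ = 1 := by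
    rw [← norm_mul, Multiset.prod_erase hz, ← det_eq_prod_roots_charpoly, hA, norm_one]
  rw [← h1]
  gcongr

/-! ### The matrix `A⁻¹ - Aᴴ`: trace above, norm below -/

/-- `z⁻¹` and `star z` have the same argument, so only their moduli are compared. -/
theorem norm_inv_sub_conj (z : ℂ) (hz : z ≠ 0) :
    ‖z⁻¹ - star z‖ = 2 * |Real.sinh (Real.log ‖z‖)| := by
  have hz' : 0 < ‖z‖ := norm_pos_iff.2 hz
  have h1 : z⁻¹ - star z = ((‖z‖⁻¹ - ‖z‖ : ℝ) : ℂ) * (star z / ‖z‖) := by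
    have h2 : z * star z = (‖z‖ : ℂ) ^ 2 := Complex.mul_conj' z
    have h3 : (‖z‖ : ℂ) ≠ 0 := by exact_mod_cast hz'.ne'
    push_cast
    field_simp
    linear_combination (1 - (‖z‖ : ℂ) ^ 2 ) * (-h2) + (‖z‖ : ℂ) ^ 2 * (-h2)
  rw [h1, Real.sinh_eq, Real.exp_neg, Real.exp_log hz', norm_mul, norm_div, norm_star]
  rw [Complex.norm_real, Complex.norm_real, norm_norm, div_self hz'.ne', mul_one,
    Real.norm_eq_abs, abs_div, abs_sub_comm, abs_two, mul_div_cancel₀ _ (two_ne_zero' ℝ)]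

/-- Both sides are minus the logarithmic derivative of the characteristic polynomial at `0`. -/
theorem trace_inv_eq_sum_roots_charpoly {n : ℕ} {A : Matrix (Fin n) (Fin n) ℂ}
    (hA : A.det = 1) : A⁻¹.trace = (A.charpoly.roots.map fun z => z⁻¹).sum := by
  have hu : IsUnit A := (isUnit_iff_isUnit_det A).2 (by simp [hA])
  have hu' : IsUnit A⁻¹ := by simpa using hu
  have hp := charpoly_inv A⁻¹ hu'
  rw [nonsing_inv_nonsing_inv A (by simp [hA]), det_nonsing_inv, hA] at hp
  simp only [Ring.inverse_one, map_one, mul_one] at hp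
  have h0 : A.charpoly.eval 0 ≠ 0 := by
    rw [hp]; simp
  have h := (IsAlgClosed.splits A.charpoly).eval_derivative_div_eval_of_ne_zero h0
  have hd : A.charpoly.derivative.eval 0 / A.charpoly.eval 0 = - A⁻¹.trace := by
    have hq : (A⁻¹.charpolyRev).derivative.eval 0 = - A⁻¹.trace := by
      rw [← coeff_charpolyRev_eq_neg_trace, ← coeff_zero_eq_eval_zero, coeff_derivative]
      simp
    have hc : ((-1 : ℂ[X]) ^ Fintype.card (Fin n)) = C ((-1) ^ Fintype.card (Fin n)) := by simp
    rw [hp, hc, derivative_C_mul, eval_mul, eval_mul, hq, eval_C, eval_charpolyRev, mul_one,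
      mul_div_cancel_left₀ _ (by simp)]
  rw [hd] at h
  have hs : (A.charpoly.roots.map fun z => 1 / (0 - z)).sum =
      -(A.charpoly.roots.map fun z => z⁻¹).sum := by
    rw [← Multiset.sum_map_neg]
    exact congrArg Multiset.sum (Multiset.map_congr rfl fun z _ => by simp [inv_neg])
  rw [hs] at h
  exact neg_injective h

theorem norm_trace_inv_sub_trace_conjTranspose_le {n : ℕ} (hn : 2 ≤ n)
    {A : Matrix (Fin n) (Fin n) ℂ} (hA : A.det = 1) :
    ‖A⁻¹.trace - Aᴴ.trace‖ ≤ n * (2 * Real.sinh ((n - 1 : ℕ) * Real.log (rho A))) := by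
  have : NeZero n := ⟨by omega⟩
  have hr := one_le_rho hA
  have hl := Real.log_nonneg hr
  rw [trace_inv_eq_sum_roots_charpoly hA, trace_conjTranspose, trace_eq_sum_roots_charpoly,
    ← starRingEnd_apply, map_multiset_sum, ← Multiset.sum_map_sub]
  have key : ∀ z ∈ A.charpoly.roots,
      ‖z⁻¹ - star z‖ ≤ 2 * Real.sinh ((n - 1 : ℕ) * Real.log (rho A)) := by
    intro z hz
    have h1 := one_le_norm_mul_rho_pow hA hz
    have hz0 : 0 < ‖z‖ := by
      by_contra! h
      have : ‖z‖ = 0 := le_antisymm h (norm_nonneg z)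
      rw [this] at h1
      norm_num at h1
    have h2 := Real.log_le_log hz0 (norm_le_rho hz)
    have h3 := Real.log_nonneg h1
    rw [Real.log_mul hz0.ne' (by positivity), Real.log_pow] at h3
    rw [norm_inv_sub_conj z (norm_pos_iff.1 hz0), Real.abs_sinh]
    have h4 : (1 : ℝ) ≤ (n - 1 : ℕ) := by exact_mod_cast (by omega : 1 ≤ n - 1)
    gcongr
    rw [Real.sinh_le_sinh]
    -- The factor `n - 1` comes from small eigenvalues: the other `n - 1` must compensate for them.
    refine abs_le.2 ⟨by linarith, h2.trans ?_⟩
    nlinarith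
  refine (norm_multiset_sum_le _).trans ?_
  rw [Multiset.map_map]
  refine (Multiset.sum_le_card_nsmul _ (2 * Real.sinh ((n - 1 : ℕ) * Real.log (rho A)))
    fun x hx => ?_).trans_eq ?_
  · obtain ⟨z, hz, rfl⟩ := Multiset.mem_map.1 hx
    exact key z hz
  · rw [Multiset.card_map, card_roots_charpoly, nsmul_eq_mul]

theorem natCast_mul_sinh_le (m : ℕ) {s : ℝ} (hs : 0 ≤ s) : m * Real.sinh s ≤ Real.sinh (m * s) := by
  induction m with
  | zero => simp
  | succ m ih =>
    have h1 := Real.one_le_cosh s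
    have h2 := Real.one_le_cosh (m * s)
    have h3 := Real.sinh_nonneg_iff.2 hs
    have h4 : 0 ≤ Real.sinh (m * s) := Real.sinh_nonneg_iff.2 (by positivity)
    push_cast
    rw [add_mul, add_mul, one_mul, one_mul, Real.sinh_add]
    nlinarith

-- `A * (A⁻¹ - Aᴴ) = 1 - A * Aᴴ` has norm at least `‖A‖² - 1`; divide by `‖A‖`.
open scoped Matrix.Norms.L2Operator in
theorem two_sinh_log_opNorm_le {n : ℕ} [NeZero n] {A : Matrix (Fin n) (Fin n) ℂ}
    (hA : A.det = 1) : 2 * Real.sinh (Real.log (opNorm A)) ≤ ‖A⁻¹ - Aᴴ‖ := by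
  have hd : 1 ≤ ‖A‖ := (one_le_rho hA).trans (rho_le_opNorm A)
  have h1 : A * (A⁻¹ - Aᴴ) = 1 - A * Aᴴ := by
    rw [mul_sub, mul_nonsing_inv A (by simp [hA])]
  have h2 : ‖A‖ * ‖A‖ - 1 ≤ ‖A‖ * ‖A⁻¹ - Aᴴ‖ := by
    calc ‖A‖ * ‖A‖ - 1 = ‖A * Aᴴ‖ - ‖(1 : Matrix (Fin n) (Fin n) ℂ)‖ := by
          rw [← star_eq_conjTranspose, CStarRing.norm_self_mul_star, norm_one]
      _ ≤ ‖A * Aᴴ - 1‖ := norm_sub_norm_le _ _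
      _ = ‖A * (A⁻¹ - Aᴴ)‖ := by rw [h1, norm_sub_rev]
      _ ≤ _ := norm_mul_le _ _
  have h0 : 0 < ‖A‖ := by linarith
  rw [opNorm_eq_norm, Real.sinh_eq, Real.exp_neg, Real.exp_log h0]
  have h3 : ‖A‖ - ‖A‖⁻¹ = (‖A‖ * ‖A‖ - 1) / ‖A‖ := by field_simp
  rw [mul_div_cancel₀ _ (two_ne_zero' ℝ), h3, div_le_iff₀ h0, mul_comm ‖_ - _‖]
  exact h2

/-! ### Measurability, and passage from real to complex matrices -/

-- By Gelfand's formula the spectral radius is a pointwise limit of continuous functions.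
open scoped Matrix.Norms.L2Operator in
theorem measurable_rho {n : ℕ} [NeZero n] [MeasurableSpace (Matrix (Fin n) (Fin n) ℂ)]
    [BorelSpace (Matrix (Fin n) (Fin n) ℂ)] :
    Measurable (rho : Matrix (Fin n) (Fin n) ℂ → ℝ) := by
  refine Measurable.ennreal_toReal (f := fun A => spectralRadius ℂ A) ?_
  refine measurable_of_tendsto_metrizable
    (f := fun (k : ℕ) (A : Matrix (Fin n) (Fin n) ℂ) => ((‖A ^ k‖₊ : ENNReal) ^ (1 / k : ℝ)))
    (fun k => ?_)
    (tendsto_pi_nhds.2 fun A => spectrum.pow_nnnorm_pow_one_div_tendsto_nhds_spectralRadius A)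
  have : Measurable fun A : Matrix (Fin n) (Fin n) ℂ => ‖A ^ k‖₊ :=
    (continuous_nnnorm.comp (continuous_pow k)).measurable
  fun_prop

theorem norm_toLp_ofReal {n : ℕ} (x : Fin n → ℝ) :
    ‖WithLp.toLp 2 (fun i => (x i : ℂ))‖ = ‖WithLp.toLp 2 x‖ := by
  simp [EuclideanSpace.norm_eq]

/-- A real matrix acts separately on real and imaginary parts, whose squared norms add. -/
theorem opNorm_map_ofReal {n : ℕ} (A : Matrix (Fin n) (Fin n) ℝ) :
    opNorm (A.map Complex.ofReal) = opNorm A := by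
  apply le_antisymm
  · refine ContinuousLinearMap.opNorm_le_bound _ (norm_nonneg _) fun v => ?_
    have hre := (toEuclideanCLM (n := Fin n) (𝕜 := ℝ) A).le_opNorm (WithLp.toLp 2 fun i => (v i).re)
    have him := (toEuclideanCLM (n := Fin n) (𝕜 := ℝ) A).le_opNorm (WithLp.toLp 2 fun i => (v i).im)
    have hsq : ∀ w : EuclideanSpace ℂ (Fin n), ‖w‖ ^ 2 =
        ‖WithLp.toLp 2 fun i => (w i).re‖ ^ 2 + ‖WithLp.toLp 2 fun i => (w i).im‖ ^ 2 := by
      intro w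
      simp only [EuclideanSpace.norm_sq_eq, ← Finset.sum_add_distrib, Real.norm_eq_abs, sq_abs]
      refine Finset.sum_congr rfl fun i _ => ?_
      rw [Complex.sq_norm, Complex.normSq_apply]; ring
    refine le_of_sq_le_sq ?_ (mul_nonneg (norm_nonneg _) (norm_nonneg _))
    rw [hsq, mul_pow, hsq v, mul_add, ← mul_pow, ← mul_pow]
    refine add_le_add (pow_le_pow_left₀ (norm_nonneg _) (le_of_eq_of_le ?_ hre) 2)
      (pow_le_pow_left₀ (norm_nonneg _) (le_of_eq_of_le ?_ him) 2)
    · congr 1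
      ext i
      simp [mulVec, dotProduct]
    · congr 1
      ext i
      simp [mulVec, dotProduct]
  · refine ContinuousLinearMap.opNorm_le_bound _ (norm_nonneg _) fun v => ?_
    have h := (toEuclideanCLM (n := Fin n) (𝕜 := ℂ) (A.map Complex.ofReal)).le_opNorm
      (WithLp.toLp 2 fun i => (v i : ℂ))
    rw [norm_toLp_ofReal] at h
    refine le_of_eq_of_le ?_ h
    rw [toEuclideanCLM_toLp]
    have : (A.map Complex.ofReal *ᵥ fun i => (v i : ℂ)) = fun i => ((A *ᵥ v.ofLp) i : ℂ) := by
      ext i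
      simp [mulVec, dotProduct]
    rw [toEuclideanCLM_toLp, this, norm_toLp_ofReal]

/-! ### Rotations span the matrices when `n ≥ 3` -/

theorem diagonal_reflection_mem {n : ℕ} (k : Fin n) :
    diagonal (Function.update (1 : Fin n → ℝ) k (-1)) ∈ orthogonalGroup (Fin n) ℝ := by
  rw [mem_orthogonalGroup_iff, diagonal_transpose, diagonal_mul_diagonal,
    ← diagonal_one]
  congr 1
  ext a
  by_cases h : a = k <;> simp [h]

theorem det_diagonal_reflection {n : ℕ} (k : Fin n) :
    (diagonal (Function.update (1 : Fin n → ℝ) k (-1))).det = -1 := by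
  rw [det_diagonal, Finset.prod_update_of_mem (Finset.mem_univ k)]
  simp

/-- The special orthogonal group, as a submonoid of the real matrices. -/
def rotations (n : ℕ) : Submonoid (Matrix (Fin n) (Fin n) ℝ) :=
  orthogonalGroup (Fin n) ℝ ⊓ MonoidHom.mker detMonoidHom

theorem mem_rotations {n : ℕ} {Q : Matrix (Fin n) (Fin n) ℝ} :
    Q ∈ rotations n ↔ Q ∈ orthogonalGroup (Fin n) ℝ ∧ Q.det = 1 := Iff.rfl

theorem reflection_mul_reflection_mem_rotations {n : ℕ} (k l : Fin n) :
    diagonal (Function.update (1 : Fin n → ℝ) k (-1)) *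
      diagonal (Function.update (1 : Fin n → ℝ) l (-1)) ∈ rotations n := by
  refine mem_rotations.2 ⟨mul_mem (diagonal_reflection_mem k) (diagonal_reflection_mem l), ?_⟩
  rw [det_mul, det_diagonal_reflection, det_diagonal_reflection]
  norm_num

theorem exists_rotation_mul_single {n : ℕ} (i j : Fin n) :
    ∃ P ∈ rotations n, P * single i i (4 : ℝ) = single j i 4 := by
  by_cases hij : i = j
  · exact ⟨1, one_mem _, by rw [hij, one_mul]⟩
  -- The sign in column `j` corrects the determinant of the swap and leaves column `i` alone.
  · refine ⟨(Equiv.swap i j).permMatrix ℝ * diagonal (Function.update (1 : Fin n → ℝ) j (-1)),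
      mem_rotations.2 ⟨mul_mem ?_ (diagonal_reflection_mem j), ?_⟩, ?_⟩
    · rw [mem_orthogonalGroup_iff, transpose_permMatrix,
        ← permMatrix_mul]
      simp
    · rw [det_mul, det_permutation, det_diagonal_reflection, Equiv.Perm.sign_swap hij]
      norm_num
    · have h : diagonal (Function.update (1 : Fin n → ℝ) j (-1)) * single i i (4 : ℝ) =
          single i i 4 := by
        ext a b
        simp only [diagonal_mul, single_apply, Function.update_apply, Pi.one_apply]
        grind
      rw [mul_assoc, h]
      ext a b
      rw [Equiv.Perm.permMatrix, PEquiv.toMatrix_toPEquiv_mul]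
      simp [single_apply, Equiv.swap_apply_def]
      grind

theorem exists_rotations_combination_eq_single {n : ℕ} (hn : 3 ≤ n) (i j : Fin n) :
    ∃ Q : Fin 4 → Matrix (Fin n) (Fin n) ℝ, (∀ k, Q k ∈ rotations n) ∧
      Q 0 - Q 1 - Q 2 + Q 3 = single j i 4 := by
  obtain ⟨k, hk⟩ : ∃ k, k ∉ ({i} : Finset (Fin n)) :=
    Finset.exists_mem_notMem_of_card_lt_card (s := {i}) (t := Finset.univ) (by simp; omega) |>.imp
      fun _ h => h.2
  obtain ⟨l, hl⟩ : ∃ l, l ∉ ({i, k} : Finset (Fin n)) :=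
    Finset.exists_mem_notMem_of_card_lt_card (s := {i, k}) (t := Finset.univ)
      (Finset.card_le_two.trans_lt (by simp; omega)) |>.imp fun _ h => h.2
  obtain ⟨P, hP, hPi⟩ := exists_rotation_mul_single i j
  let R : Fin n → Matrix (Fin n) (Fin n) ℝ := fun k =>
    diagonal (Function.update (1 : Fin n → ℝ) k (-1))
  refine ⟨![P, P * (R i * R k), P * (R i * R l), P * (R k * R l)], ?_, ?_⟩
  · intro a
    have h := fun a b => mul_mem hP (reflection_mul_reflection_mem_rotations (n := n) a b)
    fin_cases a
    exacts [hP, h i k, h i l, h k l]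
  -- Distinct `i`, `k`, `l` are needed here: the signs add up at `i` and cancel at every other
  -- entry.
  · have h : 1 - R i * R k - R i * R l + R k * R l = single i i 4 := by
      simp only [R, diagonal_mul_diagonal, ← diagonal_one, diagonal_sub, diagonal_add,
        ← diagonal_single]
      congr 1
      ext a
      simp only [Function.update_apply, Pi.single_apply, Pi.one_apply]
      simp only [Finset.mem_singleton, Finset.mem_insert, not_or] at hk hl
      grind
    rw [← hPi, ← h]
    simp [mul_add, mul_sub]

open scoped Matrix.Norms.L2Operator in
theorem exists_norm_le_norm_trace_rotation_mul {n : ℕ} (hn : 3 ≤ n) :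
    ∃ (ι : Type) (_ : Fintype ι) (_ : Nonempty ι) (q : ι → Matrix (Fin n) (Fin n) ℝ) (m : ℕ),
      (∀ a, q a ∈ rotations n) ∧ ∀ Y : Matrix (Fin n) (Fin n) ℂ,
        ∃ a, ‖Y‖ ≤ m * ‖((q a).map Complex.ofReal * Y).trace‖ := by
  have : NeZero n := ⟨by omega⟩
  choose Q hQ hQs using fun p : Fin n × Fin n =>
    exists_rotations_combination_eq_single hn p.1 p.2
  let ι := (Fin n × Fin n) × Fin 4
  let T : Matrix (Fin n) (Fin n) ℂ →ₗ[ℂ] (ι → ℂ) := LinearMap.pi fun a =>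
    traceLinearMap (Fin n) ℂ ℂ ∘ₗ LinearMap.mulLeft ℂ ((Q a.1 a.2).map Complex.ofReal)
  have hT : LinearMap.ker T = ⊥ := by
    rw [LinearMap.ker_eq_bot']
    intro Y hY
    ext i j
    have h : ∀ k, ((Q (i, j) k).map Complex.ofReal * Y).trace = 0 := fun k =>
      congrFun hY ((i, j), k)
    have hs : (single j i 4 : Matrix (Fin n) (Fin n) ℝ).map Complex.ofReal = single j i 4 := by
      ext a b
      rw [map_apply, single_apply, single_apply]
      split_ifs <;> simp
    have h4 : ((single j i 4 : Matrix (Fin n) (Fin n) ℝ).map Complex.ofReal * Y).trace = 0 := by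
      rw [← hQs (i, j), Matrix.map_add _ Complex.ofReal_add, Matrix.map_sub _ Complex.ofReal_sub,
        Matrix.map_sub _ Complex.ofReal_sub, add_mul, sub_mul, sub_mul, trace_add, trace_sub,
        trace_sub, h, h, h, h]
      simp
    rw [hs, trace_single_mul] at h4
    simpa using h4
  -- An injective linear map from a finite-dimensional space is bounded below.
  obtain ⟨K, -, hK⟩ := T.exists_antilipschitzWith hT
  obtain ⟨m, hm⟩ := exists_nat_ge (K : ℝ)
  refine ⟨ι, inferInstance, inferInstance, fun a => Q a.1 a.2, m, fun a => hQ a.1 a.2,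
    fun Y => ?_⟩
  obtain ⟨a, ha⟩ := Finite.exists_max fun a => ‖T Y a‖
  refine ⟨a, ?_⟩
  have h := hK.le_mul_norm_sub Y 0
  simp only [map_zero, add_zero, norm_neg] at h
  refine h.trans ?_
  refine mul_le_mul hm ((pi_norm_le_iff_of_nonneg (norm_nonneg _)).2 ha) (norm_nonneg _)
    (Nat.cast_nonneg m)

/-! ### The pointwise inequality -/

theorem conjTranspose_map_ofReal_of_mem_rotations {n : ℕ} {Q : Matrix (Fin n) (Fin n) ℝ}
    (hQ : Q ∈ rotations n) : (Q.map Complex.ofReal)ᴴ = (Q.map Complex.ofReal)⁻¹ := by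
  have h : Q * Qᵀ = 1 := (mem_orthogonalGroup_iff (Fin n) ℝ).1 hQ.1
  refine (inv_eq_right_inv ?_).symm
  have h1 : (Q.map Complex.ofReal)ᴴ = Qᵀ.map Complex.ofReal := by
    ext i j; simp
  rw [h1]
  change Q.map Complex.ofRealHom * Qᵀ.map Complex.ofRealHom = 1
  rw [← Matrix.map_mul, h]
  simp

theorem det_map_ofReal_eq_one {n : ℕ} {A : Matrix (Fin n) (Fin n) ℝ} (hA : A.det = 1) :
    (A.map Complex.ofReal).det = 1 := by
  have h := RingHom.map_det Complex.ofRealHom A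
  rw [hA, map_one] at h
  exact h.symm

theorem map_ofReal_mul {n : ℕ} (A B : Matrix (Fin n) (Fin n) ℝ) :
    (A * B).map Complex.ofReal = A.map Complex.ofReal * B.map Complex.ofReal :=
  Matrix.map_mul (f := Complex.ofRealHom)

theorem map_ofReal_mem_unitaryGroup {n : ℕ} {Q : Matrix (Fin n) (Fin n) ℝ}
    (hQ : Q ∈ rotations n) : Q.map Complex.ofReal ∈ unitaryGroup (Fin n) ℂ := by
  rw [mem_unitaryGroup_iff, star_eq_conjTranspose, conjTranspose_map_ofReal_of_mem_rotations hQ,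
    mul_nonsing_inv _ (by simp [det_map_ofReal_eq_one hQ.2])]

theorem exists_log_opNorm_le_sum_log_rho {n : ℕ} (hn : 3 ≤ n) :
    ∃ (ι : Type) (_ : Fintype ι) (_ : Nonempty ι) (q : ι → Matrix (Fin n) (Fin n) ℝ) (c : ℝ),
      0 < c ∧ (∀ a, q a ∈ rotations n) ∧ ∀ X : Matrix (Fin n) (Fin n) ℂ, X.det = 1 →
        Real.log (opNorm X) ≤ c * ∑ a, Real.log (rho (X * (q a).map Complex.ofReal)) := by
  have : NeZero n := ⟨by omega⟩
  obtain ⟨ι, hι, hι', q, m, hq, hqm⟩ := exists_norm_le_norm_trace_rotation_mul hn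
  have hqT : ∀ a, (q a)ᵀ ∈ rotations n := fun a =>
    mem_rotations.2 ⟨Unitary.star_mem (hq a).1, by rw [det_transpose]; exact (hq a).2⟩
  have hdet : ∀ (X : Matrix (Fin n) (Fin n) ℂ), X.det = 1 → ∀ a,
      (X * ((q a)ᵀ).map Complex.ofReal).det = 1 := by
    intro X hX a
    rw [det_mul, hX, one_mul, det_map_ofReal_eq_one (hqT a).2]
  -- Transposes, because `Z⁻¹` puts the inverse rotation on the left; the `+ 1` makes `c` positive
  -- even if `m = 0`.
  refine ⟨ι, hι, hι', fun a => (q a)ᵀ, ((m * n + 1 : ℕ) * (n - 1 : ℕ) : ℝ), ?_, hqT,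
    fun X hX => ?_⟩
  · have : 0 < n - 1 := by omega
    positivity
  obtain ⟨a, ha⟩ := hqm (X⁻¹ - Xᴴ)
  set Z := X * ((q a)ᵀ).map Complex.ofReal with hZ
  have hZ1 : Z.det = 1 := hdet X hX a
  have hQ : ((q a)ᵀ).map Complex.ofReal = ((q a).map Complex.ofReal)⁻¹ := by
    rw [← conjTranspose_map_ofReal_of_mem_rotations (hq a)]
    ext i j
    simp
  have hQu : IsUnit ((q a).map Complex.ofReal).det :=
    (det_map_ofReal_eq_one (hq a).2).symm ▸ isUnit_one
  have htr : ((q a).map Complex.ofReal * (X⁻¹ - Xᴴ)).trace = Z⁻¹.trace - Zᴴ.trace := by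
    rw [hZ, hQ, Matrix.mul_inv_rev, nonsing_inv_nonsing_inv _ hQu, conjTranspose_mul,
      ← conjTranspose_map_ofReal_of_mem_rotations (hq a), conjTranspose_conjTranspose, mul_sub,
      trace_sub]
  rw [htr] at ha
  have hl : ∀ b, 0 ≤ Real.log (rho (X * ((q b)ᵀ).map Complex.ofReal)) := fun b =>
    Real.log_nonneg (one_le_rho (hdet X hX b))
  set s := (n - 1 : ℕ) * Real.log (rho Z)
  have hs : 0 ≤ s := mul_nonneg (Nat.cast_nonneg _) (hl a)
  have h1 := (two_sinh_log_opNorm_le hX).trans ha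
  have h2 : Real.sinh (Real.log (opNorm X)) ≤ (m * n + 1 : ℕ) * Real.sinh s := by
    have h3 := mul_le_mul_of_nonneg_left
      (norm_trace_inv_sub_trace_conjTranspose_le (by omega) hZ1) (Nat.cast_nonneg (α := ℝ) m)
    have h4 : 0 ≤ Real.sinh s := Real.sinh_nonneg_iff.2 hs
    push_cast
    linarith
  have h5 := Real.sinh_le_sinh.1 (h2.trans (natCast_mul_sinh_le _ hs))
  rw [mul_assoc]
  refine h5.trans (mul_le_mul_of_nonneg_left (mul_le_mul_of_nonneg_left ?_ (Nat.cast_nonneg _))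
    (Nat.cast_nonneg _))
  -- The good index `a` depends on `X`; summing over all indices removes this dependence.
  exact Finset.single_le_sum (fun b _ => hl b) (Finset.mem_univ a)

/-! ### Integration against an invariant measure -/

theorem integral_le_of_le_sum_comp {G ι : Type*} [MeasurableSpace G] [Fintype ι] [Nonempty ι]
    {μ : Measure G} {T : ι → G → G} (hT : ∀ a, Measurable (T a)) (hμ : ∀ a, μ.map (T a) = μ)
    {f g : G → ℝ} (hf : Measurable f) (hg : Integrable g μ) (hf0 : ∀ X, 0 ≤ f X)
    (hfg : ∀ X, f X ≤ g X) {c : ℝ} (hc : 0 < c) (h : ∀ X, g X ≤ c * ∑ a, f (T a X)) :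
    Integrable f μ ∧ (c * Fintype.card ι)⁻¹ * ∫ X, g X ∂μ ≤ ∫ X, f X ∂μ := by
  have hfi : Integrable f μ := hg.mono' hf.aestronglyMeasurable
    (.of_forall fun X => by rw [Real.norm_of_nonneg (hf0 X)]; exact hfg X)
  have hmp : ∀ a, MeasurePreserving (T a) μ μ := fun a => ⟨hT a, hμ a⟩
  have hfT : ∀ a, Integrable (fun X => f (T a X)) μ := fun a =>
    (hmp a).integrable_comp_of_integrable hfi
  have hfe : ∀ a, ∫ X, f (T a X) ∂μ = ∫ X, f X ∂μ := fun a => by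
    conv_rhs => rw [← hμ a]
    exact (integral_map (hT a).aemeasurable hf.aestronglyMeasurable).symm
  refine ⟨hfi, ?_⟩
  rw [inv_mul_le_iff₀ (by positivity)]
  calc ∫ X, g X ∂μ ≤ ∫ X, c * ∑ a, f (T a X) ∂μ :=
        integral_mono hg ((integrable_finsetSum _ fun a _ => hfT a).const_mul c) h
    _ = c * Fintype.card ι * ∫ X, f X ∂μ := by
        rw [integral_const_mul, integral_finsetSum _ fun a _ => hfT a]
        simp [hfe, mul_assoc]

theorem measurable_realRho {n : ℕ} [NeZero n] [MeasurableSpace (Matrix (Fin n) (Fin n) ℝ)]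
    [BorelSpace (Matrix (Fin n) (Fin n) ℝ)] :
    Measurable (realRho : Matrix (Fin n) (Fin n) ℝ → ℝ) := by
  borelize (Matrix (Fin n) (Fin n) ℂ)
  exact measurable_rho.comp (continuous_id.matrix_map Complex.continuous_ofReal).measurable

theorem measurable_rho_specialLinearGroup {n : ℕ} [NeZero n] :
    Measurable fun X : SpecialLinearGroup (Fin n) ℂ => rho X.1 := by
  borelize (Matrix (Fin n) (Fin n) ℂ)
  exact measurable_rho.comp (Continuous.measurable
    (f := fun X : SpecialLinearGroup (Fin n) ℂ => X.1) continuous_subtype_val)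

theorem measurable_realRho_specialLinearGroup {n : ℕ} [NeZero n] :
    Measurable fun X : SpecialLinearGroup (Fin n) ℝ => realRho X.1 := by
  borelize (Matrix (Fin n) (Fin n) ℝ)
  exact measurable_realRho.comp (Continuous.measurable
    (f := fun X : SpecialLinearGroup (Fin n) ℝ => X.1) continuous_subtype_val)

end MeanRadius

theorem mainTheorem3 (n : ℕ) (hn : 3 ≤ n) :
    ∃ C : ℝ, 0 < C ∧
      (∀ μ : Measure (Matrix.SpecialLinearGroup (Fin n) ℝ),
        MeanRadius.IsOrthogonallyInvariant μ →
        Integrable (fun X => Real.log (MeanRadius.opNorm X.1)) μ →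
          Integrable (fun X => Real.log (MeanRadius.realRho X.1)) μ ∧
          C * ∫ X, Real.log (MeanRadius.opNorm X.1) ∂μ ≤
            ∫ X, Real.log (MeanRadius.realRho X.1) ∂μ) ∧
      (∀ μ : Measure (Matrix.SpecialLinearGroup (Fin n) ℂ),
        MeanRadius.IsUnitarilyInvariant μ →
        Integrable (fun X => Real.log (MeanRadius.opNorm X.1)) μ →
          Integrable (fun X => Real.log (MeanRadius.rho X.1)) μ ∧
          C * ∫ X, Real.log (MeanRadius.opNorm X.1) ∂μ ≤
            ∫ X, Real.log (MeanRadius.rho X.1) ∂μ) := by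
  have : NeZero n := ⟨by omega⟩
  obtain ⟨ι, hι, hι', q, c, hc, hq, hqc⟩ := MeanRadius.exists_log_opNorm_le_sum_log_rho hn
  refine ⟨(c * Fintype.card ι)⁻¹, by positivity, fun μ hμ hint => ?_, fun μ hμ hint => ?_⟩
  · let Q : ι → SpecialLinearGroup (Fin n) ℝ := fun a => ⟨q a, (hq a).2⟩
    have hdet := fun X : SpecialLinearGroup (Fin n) ℝ => MeanRadius.det_map_ofReal_eq_one X.2
    have hle : ∀ X : SpecialLinearGroup (Fin n) ℝ,
        Real.log (MeanRadius.realRho X.1) ≤ Real.log (MeanRadius.opNorm X.1) := fun X =>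
      Real.log_le_log (zero_lt_one.trans_le (MeanRadius.one_le_rho (hdet X)))
        ((MeanRadius.rho_le_opNorm _).trans_eq (MeanRadius.opNorm_map_ofReal _))
    have h0 : ∀ X : SpecialLinearGroup (Fin n) ℝ, 0 ≤ Real.log (MeanRadius.realRho X.1) :=
      fun X => Real.log_nonneg (MeanRadius.one_le_rho (hdet X))
    have hm := (MeanRadius.measurable_realRho_specialLinearGroup (n := n)).log
    have key := fun X : SpecialLinearGroup (Fin n) ℝ => hqc _ (hdet X)
    simp only [MeanRadius.opNorm_map_ofReal, ← MeanRadius.map_ofReal_mul] at key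
    rcases hμ with hμ | hμ
    · exact MeanRadius.integral_le_of_le_sum_comp (T := fun a X => X * Q a)
        (fun a => (continuous_mul_const (Q a)).measurable) (fun a => hμ (Q a) (hq a).1)
        hm hint h0 hle hc key
    · refine MeanRadius.integral_le_of_le_sum_comp (T := fun a X => Q a * X)
        (fun a => (continuous_const_mul (Q a)).measurable) (fun a => hμ (Q a) (hq a).1)
        hm hint h0 hle hc fun X => (key X).trans_eq ?_
      refine congrArg (c * ·) (Finset.sum_congr rfl fun a _ => congrArg Real.log ?_)
      -- Left invariance suffices too, since `X * Q` and `Q * X` have the same spectrum.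
      rw [MeanRadius.map_ofReal_mul, MeanRadius.rho_mul_comm, ← MeanRadius.map_ofReal_mul]
      rfl
  · let Q : ι → SpecialLinearGroup (Fin n) ℂ := fun a =>
      ⟨(q a).map Complex.ofReal, MeanRadius.det_map_ofReal_eq_one (hq a).2⟩
    have hQ := fun a => MeanRadius.map_ofReal_mem_unitaryGroup (hq a)
    have hle : ∀ X : SpecialLinearGroup (Fin n) ℂ,
        Real.log (MeanRadius.rho X.1) ≤ Real.log (MeanRadius.opNorm X.1) := fun X =>
      Real.log_le_log (zero_lt_one.trans_le (MeanRadius.one_le_rho X.2))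
        (MeanRadius.rho_le_opNorm _)
    have h0 : ∀ X : SpecialLinearGroup (Fin n) ℂ, 0 ≤ Real.log (MeanRadius.rho X.1) :=
      fun X => Real.log_nonneg (MeanRadius.one_le_rho X.2)
    have hm := (MeanRadius.measurable_rho_specialLinearGroup (n := n)).log
    rcases hμ with hμ | hμ
    · exact MeanRadius.integral_le_of_le_sum_comp (T := fun a X => X * Q a)
        (fun a => (continuous_mul_const (Q a)).measurable) (fun a => hμ (Q a) (hQ a))
        hm hint h0 hle hc fun X => hqc X.1 X.2
    · refine MeanRadius.integral_le_of_le_sum_comp (T := fun a X => Q a * X)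
        (fun a => (continuous_const_mul (Q a)).measurable) (fun a => hμ (Q a) (hQ a))
        hm hint h0 hle hc fun X => (hqc X.1 X.2).trans_eq ?_
      refine congrArg (c * ·) (Finset.sum_congr rfl fun a _ => congrArg Real.log ?_)
      exact MeanRadius.rho_mul_comm _ _
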